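/- Let $n\ge 1$ and let $\mathfrak g$ be the real vector space of complex $n\times n$ matrices. Write $\mathfrak g=\mathfrak l\oplus\mathfrak a$, where $\mathfrak a$ consists of the anti-Hermitian matrices and $\mathfrak l$ of the lower triangular matrices with real diagonal, and put $R(L+A)=L-A$ for $L\in\mathfrak l$, $A\in\mathfrak a$. Let $\langle X,Y\rangle=\operatorname{Im}\operatorname{tr}(XY)$, define $\nabla\phi|_B\in\mathfrak g$ by $\frac{d}{dt}\big|_{t=0}\phi(B+tC)=\langle\nabla\phi|_B,C\rangle$ for all $C\in\mathfrak g$, and let $$\{\phi,\psi\}|_B=\tfrac12\langle R(XB),YB\rangle-\tfrac12\langle R(BX),BY\rangle,\qquad X=\nabla\phi|_B,\ Y=\nabla\psi|_B .$$ The Hamiltonian vector field of a smooth real function $\phi$ on an open subset of $\mathfrak g$ is the vector field that differentiates every smooth $\psi$ to $\{\phi,\psi\}$. The symplectic leaf through $B\in\mathfrak g$ is the set of all points that can be reached from $B$ along finitely many pieces of integral curves of such Hamiltonian vector fields. Given $\alpha_0,\dots,\alpha_{n-2}\in\mathbb C$ with $|\alpha_k|<1$ and $\alpha_{n-1}$ with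 $|\alpha_{n-1}|=1$, let $\rho_k=\sqrt{1-|\alpha_k|^2}$, $\Xi_k=\begin{bmatrix}\bar\alpha_k&\rho_k\\ \rho_k&-\alpha_k\end{bmatrix}$ for $0\le k\le n-2$, $\Xi_{-1}=[1]$ and $\Xi_{n-1}=[\bar\alpha_{n-1}]$. The associated CMV matrix is the $n\times n$ matrix $\operatorname{diag}(\Xi_0,\Xi_2,\Xi_4,\dots)\operatorname{diag}(\Xi_{-1},\Xi_1,\Xi_3,\dots)$. A matrix $C\in\mathfrak g$ has CMV shape if, with rows and columns numbered from $1$, rows $2b+1$ and $2b+2$ vanish outside columns $2b,\dots,2b+3$ for every $b\ge0$, and the exposed entries, in the positions $(2,1)$, $(2j-1,2j+1)$ and $(2j+2,2j)$ with $j\ge1$ (as far as these lie in the matrix), are positive real numbers. Then the following hold. 1. The symplectic leaf through a CMV matrix $\mathcal C$ contains only CMV matrices, and all of them have determinant $\det\mathcal C$. 2. The determinant is a Casimir: $\{g\circ\det,\psi\}|_B=0$ for every $B\in\mathfrak g$, every $g:\mathbb C\to\mathbb R$ that is real differentiable at $\det B$ and every $\psi:\mathfrak g\to\mathbb R$ that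 is differentiable at $B$. 3. An integral curve of the Hamiltonian vector field of a smooth real function on an open subset of $\mathfrak g$ that is unitary at one time is unitary at all times. 4. Such an integral curve that is a CMV matrix at one time has CMV shape at all times; in particular its exposed entries remain positive. -/

import Mathlib

open scoped ContDiff

attribute [local instance] Matrix.normedAddCommGroup Matrix.normedSpace

namespace CMV

noncomputable section

/-- The algebra `𝔤` of complex `n × n` matrices. Its real normed space structure (entrywise sup
norm) only serves to speak of derivatives; all norms on it are equivalent. -/
abbrev Mat (n : ℕ) : Type := Matrix (Fin n) (Fin n) ℂ

/-! ### CMV matrices (rows and columns are numbered from `0`) -/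

/-- `α₀, …, α_{n-2}` lie in the open unit disk and `α_{n-1}` on the unit circle. -/
def IsVerblunsky {n : ℕ} (α : Fin n → ℂ) : Prop :=
  ∀ k : Fin n, ((k : ℕ) + 1 < n → ‖α k‖ < 1) ∧ ((k : ℕ) + 1 = n → ‖α k‖ = 1)

/-- `ρ = √(1 - |α|²)`. -/
def rho (a : ℂ) : ℝ := Real.sqrt (1 - ‖a‖ ^ 2)

/-- The block diagonal matrix whose blocks are the `Ξ_k` with `k ≡ p (mod 2)`, where
`Ξ_k = [[conj α_k, ρ_k], [ρ_k, -α_k]]` occupies the rows and columns `k, k + 1`. The block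
`Ξ_{n-1} = [conj α_{n-1}]` is cut down to the last row and column, and for `p = 1` the block
`Ξ_{-1} = [1]` occupies row and column `0`. -/
def cmvFactor {n : ℕ} (p : ℕ) (α : Fin n → ℂ) : Mat n :=
  Matrix.of fun i j =>
    if (i : ℕ) = j then
      if (i : ℕ) % 2 = p then (starRingEnd ℂ) (α i)
      else if (i : ℕ) = 0 then 1
      else -α ⟨(i : ℕ) - 1, lt_of_le_of_lt (Nat.sub_le _ _) i.isLt⟩
    else if (j : ℕ) = i + 1 ∧ (i : ℕ) % 2 = p then (rho (α i) : ℂ)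
    else if (i : ℕ) = j + 1 ∧ (j : ℕ) % 2 = p then (rho (α j) : ℂ)
    else 0

/-- The CMV matrix `𝓛𝓜`, with `𝓛 = diag(Ξ₀, Ξ₂, …)` and `𝓜 = diag(Ξ₋₁, Ξ₁, Ξ₃, …)`. -/
def cmvMatrix {n : ℕ} (α : Fin n → ℂ) : Mat n := cmvFactor 0 α * cmvFactor 1 α

/-- `C` is a CMV matrix. -/
def IsCMV {n : ℕ} (C : Mat n) : Prop :=
  ∃ α : Fin n → ℂ, IsVerblunsky α ∧ C = cmvMatrix α

/-- The exposed positions; numbered from `1` they are `(2,1)`, `(2j-1,2j+1)` and `(2j+2,2j)`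
with `j ≥ 1`. -/
def IsExposed {n : ℕ} (i j : Fin n) : Prop :=
  ((i : ℕ) = 1 ∧ (j : ℕ) = 0) ∨ ((i : ℕ) % 2 = 0 ∧ (j : ℕ) = i + 2) ∨
    ((j : ℕ) % 2 = 1 ∧ (i : ℕ) = j + 2)

/-- CMV shape: numbered from `0`, the rows `2b, 2b + 1` vanish outside the columns
`2b - 1, …, 2b + 2`, and the exposed entries are positive reals. -/
def HasCMVShape {n : ℕ} (C : Mat n) : Prop :=
  (∀ i j : Fin n, ¬ (2 * ((i : ℕ) / 2) ≤ (j : ℕ) + 1 ∧ (j : ℕ) ≤ 2 * ((i : ℕ) / 2) + 2) →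
      C i j = 0) ∧
    ∀ i j : Fin n, IsExposed i j → 0 < (C i j).re ∧ (C i j).im = 0

/-! ### The splitting `𝔤 = 𝔩 ⊕ 𝔞` -/

/-- `𝔞`: the anti-Hermitian matrices. -/
def antiHerm (n : ℕ) : Submodule ℝ (Mat n) where
  carrier := {A | A.conjTranspose = -A}
  add_mem' {A B} hA hB := by
    simp only [Set.mem_ofPred_eq] at *
    rw [Matrix.conjTranspose_add, hA, hB, neg_add]
  zero_mem' := by simp
  smul_mem' c A hA := by
    simp only [Set.mem_ofPred_eq] at *
    rw [Matrix.conjTranspose_smul, hA, smul_neg, star_trivial]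

/-- `𝔩`: the lower triangular matrices with real diagonal. -/
def lowerTri (n : ℕ) : Submodule ℝ (Mat n) where
  carrier := {L | (∀ i j, i < j → L i j = 0) ∧ ∀ i, (L i i).im = 0}
  add_mem' {A B} hA hB :=
    ⟨fun i j h => by simp [hA.1 i j h, hB.1 i j h], fun i => by simp [hA.2 i, hB.2 i]⟩
  zero_mem' := ⟨fun _ _ _ => rfl, fun _ => rfl⟩
  smul_mem' c A hA := ⟨fun i j h => by simp [hA.1 i j h], fun i => by simp [hA.2 i]⟩

/-- The projection onto `𝔞` along `𝔩`. -/
def piA {n : ℕ} (X : Mat n) : Mat n :=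
  Matrix.of fun i j =>
    if i < j then X i j
    else if j < i then -(starRingEnd ℂ) (X j i)
    else Complex.I * ((X i i).im : ℂ)

/-- The projection onto `𝔩` along `𝔞`. -/
def piL {n : ℕ} (X : Mat n) : Mat n := X - piA X

theorem piA_mem {n : ℕ} (X : Mat n) : piA X ∈ antiHerm n := by
  change (piA X).conjTranspose = -piA X
  ext i j
  rcases lt_trichotomy i j with h | h | h
  · simp [piA, h, h.not_gt]
  · subst h; simp [piA]
  · simp [piA, h, h.not_gt]

theorem piL_mem {n : ℕ} (X : Mat n) : piL X ∈ lowerTri n := by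
  refine ⟨fun i j h => ?_, fun i => ?_⟩
  · simp [piL, piA, h]
  · simp [piL, piA]

theorem piA_add {n : ℕ} {L A : Mat n} (hL : L ∈ lowerTri n) (hA : A ∈ antiHerm n) :
    piA (L + A) = A := by
  have hA' : ∀ i j, (starRingEnd ℂ) (A j i) = -A i j := fun i j => by
    have := congrFun (congrFun (show A.conjTranspose = -A from hA) i) j
    simpa using this
  ext i j
  rcases lt_trichotomy i j with h | h | h
  · simp [piA, h, hL.1 i j h]
  · subst h
    have h1 := congrArg Complex.re (hA' i i)
    simp only [Complex.conj_re, Complex.neg_re] at h1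
    apply Complex.ext
    · simp [piA]; linarith
    · simp [piA, hL.2 i]
  · simp [piA, h, h.not_gt, hL.1 j i h, hA' i j]

theorem piL_add {n : ℕ} {L A : Mat n} (hL : L ∈ lowerTri n) (hA : A ∈ antiHerm n) :
    piL (L + A) = L := by
  rw [piL, piA_add hL hA, add_sub_cancel_right]

/-- `R(L + A) = L - A` for `L ∈ 𝔩` and `A ∈ 𝔞`. -/
def R {n : ℕ} (X : Mat n) : Mat n := piL X - piA X

/-! ### The Poisson bracket, Hamiltonian vectors, symplectic leaves -/

/-- The pairing `⟨X, Y⟩ = Im tr (XY)`. -/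
def pairing {n : ℕ} (X Y : Mat n) : ℝ := ((X * Y).trace).im

/-- The gradient: `[∇φ]_{k,l} = ∂φ/∂v_{l,k} + i ∂φ/∂u_{l,k}`, where `b = u + i v` are the matrix
entries. -/
def grad {n : ℕ} (φ : Mat n → ℝ) (B : Mat n) : Mat n :=
  Matrix.of fun k l =>
    (fderiv ℝ φ B (Matrix.single l k Complex.I) : ℂ) +
      Complex.I * (fderiv ℝ φ B (Matrix.single l k 1) : ℂ)

/-- The gradient represents the differential through the pairing. -/
theorem pairing_grad {n : ℕ} (φ : Mat n → ℝ) (B C : Mat n) :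
    pairing (grad φ B) C = fderiv ℝ φ B C := by
  have hC : C = ∑ l, ∑ k, ((C l k).re • Matrix.single l k (1 : ℂ)
      + (C l k).im • Matrix.single l k Complex.I) := by
    conv_lhs => rw [Matrix.matrix_eq_sum_single C]
    refine Finset.sum_congr rfl fun l _ => Finset.sum_congr rfl fun k _ => ?_
    rw [Matrix.smul_single, Matrix.smul_single, ← Matrix.single_add]
    congr 1
    apply Complex.ext <;> simp
  conv_rhs => rw [hC]
  simp only [map_sum, map_add, map_smul, smul_eq_mul]
  simp only [pairing, Matrix.trace, Matrix.diag, Matrix.mul_apply, Complex.im_sum]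
  rw [Finset.sum_comm]
  refine Finset.sum_congr rfl fun l _ => Finset.sum_congr rfl fun k _ => ?_
  simp [grad, Complex.mul_im]
  ring

/-- The bracket `{φ, ψ}|_B = ½⟨R(XB), YB⟩ - ½⟨R(BX), BY⟩` with `X = ∇φ|_B`, `Y = ∇ψ|_B`. -/
def poissonBracket {n : ℕ} (φ ψ : Mat n → ℝ) (B : Mat n) : ℝ :=
  1 / 2 * pairing (R (grad φ B * B)) (grad ψ B * B)
    - 1 / 2 * pairing (R (B * grad φ B)) (B * grad ψ B)

/-- `V` is the value at `B` of the Hamiltonian vector field of `φ`: its derivative of any smooth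
function `ψ` is `{φ, ψ}`. -/
def IsHamiltonianVector {n : ℕ} (φ : Mat n → ℝ) (B V : Mat n) : Prop :=
  ∀ ψ : Mat n → ℝ, ContDiff ℝ ∞ ψ → fderiv ℝ ψ B V = poissonBracket φ ψ B

/-- `γ`, restricted to the interval `s`, is an integral curve of the Hamiltonian vector field of
a smooth function `φ` that is defined on the open set `U`. -/
structure IsHamiltonianCurve {n : ℕ} (U : Set (Mat n)) (φ : Mat n → ℝ) (s : Set ℝ)
    (γ : ℝ → Mat n) : Prop where
  isOpen : IsOpen U
  smooth : ContDiffOn ℝ ∞ φ U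
  ordConnected : s.OrdConnected
  mem : ∀ t ∈ s, γ t ∈ U
  deriv : ∀ t ∈ s, ∃ V, IsHamiltonianVector φ (γ t) V ∧ HasDerivWithinAt γ V s t

/-- `B` and `B'` are the end points of a Hamiltonian curve. -/
def HamiltonianStep {n : ℕ} (B B' : Mat n) : Prop :=
  ∃ (U : Set (Mat n)) (φ : Mat n → ℝ) (T : ℝ) (γ : ℝ → Mat n),
    0 ≤ T ∧ IsHamiltonianCurve U φ (Set.Icc 0 T) γ ∧ γ 0 = B ∧ γ T = B'

/-- The symplectic leaf through `B`: all points that can be reached from `B` along finitely many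
pieces of integral curves of (locally defined) Hamiltonian vector fields. -/
def symplecticLeaf {n : ℕ} (B : Mat n) : Set (Mat n) :=
  {B' | Relation.ReflTransGen HamiltonianStep B B'}

end

end CMV

/-!
The Hamiltonian equation is linear along a curve `B`: it reads `B' = K B - B L` with `K = π_𝔞(B X)`
and `L = π_𝔞(X B)`, where `X = ∇φ`. As `B X B = B (X B)`, the pair `(K, L)` may be replaced by
`(-π_𝔩(B X), -π_𝔩(X B))`. With `K` and `L` anti-Hermitian of equal trace, uniqueness of solutions
gives `B* B = 1`, and the determinant is constant. With `K` and `L` lower triangular, the equation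
preserves the vanishing of all entries above and to the right of a position, and an entry above and
to the right of which everything vanishes solves a real scalar linear equation, so that it keeps
its sign. A unitary `B` has `B* = B⁻¹`, which solves the equation with `K` and `L` interchanged;
this treats the entries below and to the left of the band.

It remains to see that the CMV matrices are exactly the unitary matrices of CMV shape. If `𝓛𝓜` is
the CMV matrix of `α₀, α₁, …`, then `𝓛 = (Ξ₀ ⊕ 1)(1 ⊕ 𝓜')` and `𝓜 = 1 ⊕ 𝓛'`, where `𝓛'𝓜'` is the
CMV matrix of `α₁, α₂, …`, and `𝓜'𝓛'` is its transpose. Conversely, the first column of a unitary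
matrix of CMV shape is that of a unique `Ξ₀ ⊕ 1`, which can be split off.
-/

namespace CMV

open Matrix Set

/-! ### Linear differential equations -/

section LinearODE

variable {E : Type*} [NormedAddCommGroup E] [NormedSpace ℝ E] {s : Set ℝ} {t₀ t : ℝ}

theorem eq_zero_of_norm_deriv_le_of_le (hs : s.OrdConnected) {y y' : ℝ → E} {K : ℝ → ℝ}
    (hK : ContinuousOn K s) (hy : ∀ t ∈ s, HasDerivWithinAt y (y' t) s t)
    (hb : ∀ t ∈ s, ‖y' t‖ ≤ K t * ‖y t‖) (ht₀ : t₀ ∈ s) (ht : t ∈ s) (hle : t₀ ≤ t)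
    (h0 : y t₀ = 0) : y t = 0 := by
  have hsub : Icc t₀ t ⊆ s := hs.out ht₀ ht
  obtain ⟨M, hM⟩ := isCompact_Icc.bddAbove_image (hK.mono hsub)
  have hd : ∀ x ∈ Icc t₀ t, HasDerivWithinAt y (y' x) (Icc t₀ t) x := fun x hx =>
    (hy x (hsub hx)).mono hsub
  refine eq_zero_of_abs_deriv_le_mul_abs_self_of_eq_zero_right (K := M)
    (fun x hx => (hd x hx).continuousWithinAt)
    (fun x hx => (hd x (Ico_subset_Icc_self hx)).mono_of_mem_nhdsWithin (Icc_mem_nhdsGE_of_mem hx))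
    h0 (fun x hx => ?_) t ⟨hle, le_rfl⟩
  have hx' := Ico_subset_Icc_self hx
  exact (hb x (hsub hx')).trans
    (mul_le_mul_of_nonneg_right (hM (mem_image_of_mem K hx')) (norm_nonneg _))

theorem eq_zero_of_norm_deriv_le (hs : s.OrdConnected) {y y' : ℝ → E} {K : ℝ → ℝ}
    (hK : ContinuousOn K s) (hy : ∀ t ∈ s, HasDerivWithinAt y (y' t) s t)
    (hb : ∀ t ∈ s, ‖y' t‖ ≤ K t * ‖y t‖) (ht₀ : t₀ ∈ s) (ht : t ∈ s) (h0 : y t₀ = 0) :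
    y t = 0 := by
  rcases le_total t₀ t with h | h
  · exact eq_zero_of_norm_deriv_le_of_le hs hK hy hb ht₀ ht h h0
  have hmaps : MapsTo (fun x : ℝ => -x) (Neg.neg ⁻¹' s) s := fun x hx => hx
  have hd : ∀ x ∈ Neg.neg ⁻¹' s,
      HasDerivWithinAt (fun x => y (-x)) (-y' (-x)) (Neg.neg ⁻¹' s) x := fun x hx =>
    ((hy (-x) hx).scomp x (hasDerivAt_neg x).hasDerivWithinAt hmaps).congr_deriv
      (neg_one_smul ℝ _)
  have key := eq_zero_of_norm_deriv_le_of_le (t₀ := -t₀) (t := -t)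
    (hs.preimage_anti fun _ _ => neg_le_neg) (hK.comp continuousOn_neg hmaps) hd
    (fun x hx => by simpa only [norm_neg, Function.comp_apply] using hb (-x) hx)
    (by simpa using ht₀) (by simpa using ht) (neg_le_neg h) (by simpa only [neg_neg] using h0)
  simpa only [neg_neg] using key

theorem norm_mk_apply_le {L : E →L[ℝ] E} {V : Submodule ℝ E} (hL : ∀ v ∈ V, L v ∈ V) (x : E) :
    ‖V.mkQ (L x)‖ ≤ ‖L‖ * ‖V.mkQ x‖ := by
  refine le_of_forall_pos_le_add fun ε hε => ?_
  have hδ : 0 < ε / (‖L‖ + 1) := by positivity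
  obtain ⟨m, hm, hlt⟩ := Submodule.Quotient.norm_mk_lt (V.mkQ x) hδ
  have hmem : L x - L m ∈ V := by
    rw [← map_sub]
    exact hL _ ((Submodule.Quotient.eq V).1 hm.symm)
  have hmk : V.mkQ (L x) = V.mkQ (L m) := (Submodule.Quotient.eq V).2 hmem
  calc ‖V.mkQ (L x)‖ = ‖V.mkQ (L m)‖ := by rw [hmk]
    _ ≤ ‖L m‖ := Submodule.Quotient.norm_mk_le V _
    _ ≤ ‖L‖ * ‖m‖ := L.le_opNorm m
    _ ≤ ‖L‖ * (‖V.mkQ x‖ + ε / (‖L‖ + 1)) := by gcongr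
    _ ≤ ‖L‖ * ‖V.mkQ x‖ + ε := by
      have : ‖L‖ * (ε / (‖L‖ + 1)) ≤ ε := by
        rw [← mul_div_assoc, div_le_iff₀ (by positivity)]
        nlinarith
      linarith

theorem mem_submodule_of_deriv_eq_apply (hs : s.OrdConnected) {y : ℝ → E} {L : ℝ → E →L[ℝ] E}
    (hL : ContinuousOn L s) (hy : ∀ t ∈ s, HasDerivWithinAt y (L t (y t)) s t)
    {V : Submodule ℝ E} (hV : IsClosed (V : Set E)) (hLV : ∀ t ∈ s, ∀ v ∈ V, L t v ∈ V)
    (ht₀ : t₀ ∈ s) (ht : t ∈ s) (h0 : y t₀ ∈ V) : y t ∈ V := by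
  have := hV
  rw [← Submodule.Quotient.mk_eq_zero V] at h0 ⊢
  exact eq_zero_of_norm_deriv_le hs hL.norm
    (fun x hx => V.mkQL.hasFDerivAt.comp_hasDerivWithinAt x (hy x hx))
    (fun x hx => norm_mk_apply_le (hLV x hx) (y x)) ht₀ ht h0

theorem pos_of_deriv_eq_mul (hs : s.OrdConnected) {y c : ℝ → ℝ} (hc : ContinuousOn c s)
    (hy : ∀ t ∈ s, HasDerivWithinAt y (c t * y t) s t) (ht₀ : t₀ ∈ s) (ht : t ∈ s)
    (h0 : 0 < y t₀) : 0 < y t := by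
  by_contra! h
  have hcont : ContinuousOn y s := fun x hx => (hy x hx).continuousWithinAt
  obtain ⟨z, hz, hz0⟩ := hs.isPreconnected.intermediate_value ht ht₀ hcont ⟨h, h0.le⟩
  exact h0.ne' (eq_zero_of_norm_deriv_le hs hc.norm hy (fun x _ => (norm_mul _ _).le) hz ht₀ hz0)

theorem re_pos_of_deriv_eq_mul (hs : s.OrdConnected) {y : ℝ → ℂ} {c : ℝ → ℝ}
    (hc : ContinuousOn c s) (hy : ∀ t ∈ s, HasDerivWithinAt y (c t * y t) s t) (ht₀ : t₀ ∈ s)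
    (ht : t ∈ s) (h0 : 0 < (y t₀).re ∧ (y t₀).im = 0) : 0 < (y t).re ∧ (y t).im = 0 := by
  have hre : ∀ t ∈ s, HasDerivWithinAt (fun t => (y t).re) (c t * (y t).re) s t := fun t ht =>
    (Complex.reCLM.hasFDerivAt.comp_hasDerivWithinAt t (hy t ht)).congr_deriv
      (Complex.re_ofReal_mul _ _)
  have him : ∀ t ∈ s, HasDerivWithinAt (fun t => (y t).im) (c t * (y t).im) s t := fun t ht =>
    (Complex.imCLM.hasFDerivAt.comp_hasDerivWithinAt t (hy t ht)).congr_deriv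
      (Complex.im_ofReal_mul _ _)
  exact ⟨pos_of_deriv_eq_mul hs hc hre ht₀ ht h0.1,
    eq_zero_of_norm_deriv_le hs hc.norm him (fun x _ => (norm_mul _ _).le) ht₀ ht h0.2⟩

theorem eq_of_deriv_eq_zero (hs : s.OrdConnected) {y : ℝ → E}
    (hy : ∀ t ∈ s, HasDerivWithinAt y 0 s t) (ht₀ : t₀ ∈ s) (ht : t ∈ s) : y t = y t₀ := by
  have h := hs.convex.norm_image_sub_le_of_norm_hasDerivWithin_le (C := 0) hy
    (fun _ _ => norm_zero.le) ht₀ ht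
  rwa [zero_mul, norm_le_zero_iff, sub_eq_zero] at h

end LinearODE

/-! ### Lax flows -/

theorem sum_det_updateRow {m A : Type*} [Fintype m] [DecidableEq m] [CommRing A]
    (B C : Matrix m m A) : ∑ i, (B.updateRow i (C i)).det = (adjugate B * C).trace := by
  rw [Matrix.trace_mul_comm]
  refine Finset.sum_congr rfl fun i _ => ?_
  rw [diag_apply, mul_apply, ← cramer_transpose_apply, cramer_eq_adjugate_mulVec,
    ← adjugate_transpose, mulVec, dotProduct]
  exact Finset.sum_congr rfl fun k _ => mul_comm _ _

theorem hasFDerivAt_det {m 𝕜 : Type*} [Fintype m] [DecidableEq m] [NontriviallyNormedField 𝕜]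
    [CompleteSpace 𝕜] (B : Matrix m m 𝕜) :
    HasFDerivAt det (LinearMap.toContinuousLinearMap
      (traceLinearMap m 𝕜 𝕜 ∘ₗ LinearMap.mulLeft 𝕜 (adjugate B))) B := by
  let D : ContinuousMultilinearMap 𝕜 (fun _ : m => m → 𝕜) 𝕜 :=
    ⟨detRowAlternating.toMultilinearMap, continuous_id.matrix_det⟩
  refine (D.hasFDerivAt B).congr_fderiv (ContinuousLinearMap.ext fun C => ?_)
  exact (D.linearDeriv_apply B C).trans (sum_det_updateRow B C)

section LaxFlow

variable {n : ℕ}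

theorem lowerTri_mul_apply {K X : Mat n} (hK : K ∈ lowerTri n) {i j : Fin n}
    (h : ∀ k < i, X k j = 0) : (K * X) i j = (K i i).re * X i j := by
  rw [mul_apply, Finset.sum_eq_single i (fun k _ hk => ?_) (by simp)]
  · rw [Complex.ext (Complex.ofReal_re _) ((Complex.ofReal_im _).trans (hK.2 i).symm)]
  · rcases hk.lt_or_gt with hlt | hgt
    · rw [h k hlt, mul_zero]
    · rw [hK.1 i k hgt, zero_mul]

theorem mul_lowerTri_apply {L X : Mat n} (hL : L ∈ lowerTri n) {i j : Fin n}
    (h : ∀ k > j, X i k = 0) : (X * L) i j = (L j j).re * X i j := by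
  rw [mul_apply, Finset.sum_eq_single j (fun k _ hk => ?_) (by simp), mul_comm]
  · rw [Complex.ext (Complex.ofReal_re _) ((Complex.ofReal_im _).trans (hL.2 j).symm)]
  · rcases hk.lt_or_gt with hlt | hgt
    · rw [hL.1 k j hlt, mul_zero]
    · rw [h k hgt, zero_mul]

/-- The matrices that vanish above and to the right of the position `(i, j)`, including it. -/
def vanishingUpperRight (i j : Fin n) : Submodule ℝ (Mat n) where
  carrier := {X | ∀ i' ≤ i, ∀ j' ≥ j, X i' j' = 0}
  add_mem' hX hY i' hi j' hj := by simp [hX i' hi j' hj, hY i' hi j' hj]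
  zero_mem' _ _ _ _ := rfl
  smul_mem' c X hX i' hi j' hj := by simp [hX i' hi j' hj]

theorem mul_sub_mul_mem_vanishingUpperRight {K L X : Mat n} (hK : K ∈ lowerTri n)
    (hL : L ∈ lowerTri n) {i j : Fin n} (hX : X ∈ vanishingUpperRight i j) :
    K * X - X * L ∈ vanishingUpperRight i j := fun i' hi j' hj => by
  rw [Matrix.sub_apply, lowerTri_mul_apply hK fun k hk => hX k (hk.le.trans hi) j' hj,
    mul_lowerTri_apply hL fun k hk => hX i' hi k (hj.trans hk.le), hX i' hi j' hj, mul_zero,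
    mul_zero, sub_zero]

/-- `F` solves the linear equation `F' = K F - F L` on the interval `s`. Composing solutions
composes the pairs `(K, L)` like arrows from `L` to `K`. -/
structure IsLaxFlow (s : Set ℝ) (K L F : ℝ → Mat n) : Prop where
  ordConnected : s.OrdConnected
  continuousOn_left : ContinuousOn K s
  continuousOn_right : ContinuousOn L s
  deriv : ∀ t ∈ s, HasDerivWithinAt F (K t * F t - F t * L t) s t

namespace IsLaxFlow

variable {s : Set ℝ} {K K' L L' M F G : ℝ → Mat n} {t₀ t : ℝ}

theorem congr (hF : IsLaxFlow s K L F) (hK : ContinuousOn K' s) (hL : ContinuousOn L' s)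
    (h : ∀ t ∈ s, K t * F t - F t * L t = K' t * F t - F t * L' t) : IsLaxFlow s K' L' F :=
  ⟨hF.ordConnected, hK, hL, fun t ht => (hF.deriv t ht).congr_deriv (h t ht)⟩

theorem mul (hF : IsLaxFlow s K L F) (hG : IsLaxFlow s L M G) :
    IsLaxFlow s K M fun t => F t * G t := by
  refine ⟨hF.ordConnected, hF.continuousOn_left, hG.continuousOn_right, fun t ht => ?_⟩
  refine ((LinearMap.mul ℝ (Mat n)).toContinuousBilinearMap.hasDerivWithinAt_of_bilinear
    (hF.deriv t ht) (hG.deriv t ht)).congr_deriv ?_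
  change F t * (L t * G t - G t * M t) + (K t * F t - F t * L t) * G t = _
  noncomm_ring

theorem sub (hF : IsLaxFlow s K L F) (hG : IsLaxFlow s K L G) :
    IsLaxFlow s K L fun t => F t - G t :=
  ⟨hF.ordConnected, hF.continuousOn_left, hF.continuousOn_right, fun t ht =>
    ((hF.deriv t ht).sub (hG.deriv t ht)).congr_deriv (by noncomm_ring)⟩

theorem one (hs : s.OrdConnected) (hL : ContinuousOn L s) : IsLaxFlow s L L fun _ => 1 :=
  ⟨hs, hL, hL, fun t _ => (hasDerivWithinAt_const t s 1).congr_deriv (by simp)⟩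

theorem star (hF : IsLaxFlow s K L F) (hK : ∀ t ∈ s, K t ∈ antiHerm n)
    (hL : ∀ t ∈ s, L t ∈ antiHerm n) : IsLaxFlow s L K fun t => star (F t) := by
  refine ⟨hF.ordConnected, hF.continuousOn_right, hF.continuousOn_left, fun t ht => ?_⟩
  have hK' : Star.star (K t) = -K t := hK t ht
  have hL' : Star.star (L t) = -L t := hL t ht
  refine (hF.deriv t ht).star.congr_deriv ?_
  rw [star_sub, star_mul, star_mul, hK', hL']
  noncomm_ring

theorem mem (hF : IsLaxFlow s K L F) {V : Submodule ℝ (Mat n)}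
    (hV : ∀ t ∈ s, ∀ X ∈ V, K t * X - X * L t ∈ V) (ht₀ : t₀ ∈ s) (ht : t ∈ s)
    (h0 : F t₀ ∈ V) : F t ∈ V := by
  let lax : Mat n × Mat n →ₗ[ℝ] Mat n →ₗ[ℝ] Mat n :=
    LinearMap.mul ℝ (Mat n) ∘ₗ LinearMap.fst ℝ _ _ -
      (LinearMap.mul ℝ (Mat n)).flip ∘ₗ LinearMap.snd ℝ _ _
  exact mem_submodule_of_deriv_eq_apply hF.ordConnected
    (L := fun t => lax.toContinuousBilinearMap (K t, L t))
    (lax.toContinuousBilinearMap.continuous.comp_continuousOn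
      (hF.continuousOn_left.prodMk hF.continuousOn_right))
    hF.deriv V.closed_of_finiteDimensional hV ht₀ ht h0

theorem eq (hF : IsLaxFlow s K L F) (hG : IsLaxFlow s K L G) (ht₀ : t₀ ∈ s) (ht : t ∈ s)
    (h0 : F t₀ = G t₀) : F t = G t :=
  sub_eq_zero.1 ((hF.sub hG).mem (V := ⊥) (by simp) ht₀ ht (sub_eq_zero.2 h0))

theorem mem_unitaryGroup (hF : IsLaxFlow s K L F) (hK : ∀ t ∈ s, K t ∈ antiHerm n)
    (hL : ∀ t ∈ s, L t ∈ antiHerm n) (ht₀ : t₀ ∈ s) (ht : t ∈ s)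
    (h0 : F t₀ ∈ unitaryGroup (Fin n) ℂ) : F t ∈ unitaryGroup (Fin n) ℂ :=
  mem_unitaryGroup_iff'.2 <| ((hF.star hK hL).mul hF).eq
    (one hF.ordConnected hF.continuousOn_right) ht₀ ht (mem_unitaryGroup_iff'.1 h0)

theorem hasDerivWithinAt_det (hF : IsLaxFlow s K L F) (ht : t ∈ s) :
    HasDerivWithinAt (fun t => (F t).det) (((K t).trace - (L t).trace) * (F t).det) s t := by
  refine (((hasFDerivAt_det (F t)).restrictScalars ℝ).comp_hasDerivWithinAt t
    (hF.deriv t ht)).congr_deriv ?_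
  change (adjugate (F t) * (K t * F t - F t * L t)).trace = _
  rw [mul_sub, Matrix.trace_sub, Matrix.trace_mul_comm, mul_assoc, mul_adjugate, ← mul_assoc,
    adjugate_mul, mul_smul_comm, smul_mul_assoc, mul_one, one_mul, Matrix.trace_smul,
    Matrix.trace_smul, smul_eq_mul, smul_eq_mul]
  ring

theorem det_eq (hF : IsLaxFlow s K L F) (hKL : ∀ t ∈ s, (K t).trace = (L t).trace)
    (ht₀ : t₀ ∈ s) (ht : t ∈ s) : (F t).det = (F t₀).det :=
  eq_of_deriv_eq_zero hF.ordConnected (fun x hx => (hF.hasDerivWithinAt_det hx).congr_deriv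
    (by rw [hKL x hx, sub_self, zero_mul])) ht₀ ht

theorem entry_eq_zero (hF : IsLaxFlow s K L F) (hK : ∀ t ∈ s, K t ∈ lowerTri n)
    (hL : ∀ t ∈ s, L t ∈ lowerTri n) (ht₀ : t₀ ∈ s) (ht : t ∈ s) {i j : Fin n}
    (h0 : ∀ i' ≤ i, ∀ j' ≥ j, F t₀ i' j' = 0) : F t i j = 0 :=
  hF.mem (V := vanishingUpperRight i j)
    (fun x hx _ hX => mul_sub_mul_mem_vanishingUpperRight (hK x hx) (hL x hx) hX)
    ht₀ ht h0 i le_rfl j le_rfl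

theorem entry_pos (hF : IsLaxFlow s K L F) (hK : ∀ t ∈ s, K t ∈ lowerTri n)
    (hL : ∀ t ∈ s, L t ∈ lowerTri n) (ht₀ : t₀ ∈ s) (ht : t ∈ s) {i j : Fin n}
    (h0 : ∀ i' ≤ i, ∀ j' ≥ j, (i', j') ≠ (i, j) → F t₀ i' j' = 0)
    (hpos : 0 < (F t₀ i j).re ∧ (F t₀ i j).im = 0) : 0 < (F t i j).re ∧ (F t i j).im = 0 := by
  have hup : ∀ t ∈ s, ∀ k < i, F t k j = 0 := fun t ht k hk =>
    hF.entry_eq_zero hK hL ht₀ ht fun i' hi' j' hj' =>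
      h0 i' (hi'.trans hk.le) j' hj' fun h => (hi'.trans_lt hk).ne (congrArg Prod.fst h)
  have hright : ∀ t ∈ s, ∀ k > j, F t i k = 0 := fun t ht k hk =>
    hF.entry_eq_zero hK hL ht₀ ht fun i' hi' j' hj' =>
      h0 i' hi' j' (hk.le.trans hj') fun h => (hk.trans_le hj').ne' (congrArg Prod.snd h)
  have hre : ∀ i, Continuous fun X : Mat n => (X i i).re := fun i =>
    Complex.continuous_re.comp (continuous_id.matrix_elem i i)
  refine re_pos_of_deriv_eq_mul (y := fun t => F t i j) (c := fun t => (K t i i).re - (L t j j).re)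
    hF.ordConnected (((hre i).comp_continuousOn hF.continuousOn_left).sub
      ((hre j).comp_continuousOn hF.continuousOn_right)) (fun x hx => ?_) ht₀ ht hpos
  refine (hasDerivWithinAt_pi.1 (hasDerivWithinAt_pi.1 (hF.deriv x hx) i) j).congr_deriv ?_
  rw [Matrix.sub_apply, lowerTri_mul_apply (hK x hx) (hup x hx),
    mul_lowerTri_apply (hL x hx) (hright x hx), ← sub_mul, ← Complex.ofReal_sub]

end IsLaxFlow

end LaxFlow

/-! ### Hamiltonian curves -/

section HamiltonianVector

variable {n : ℕ} {φ ψ : Mat n → ℝ} {B V Z W : Mat n}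

theorem pairing_comm (Z W : Mat n) : pairing Z W = pairing W Z := by
  rw [pairing, pairing, Matrix.trace_mul_comm]

theorem pairing_single (Z : Mat n) (i j : Fin n) (c : ℂ) :
    pairing Z (Matrix.single i j c) = (Z j i * c).im := by
  simp [pairing, Matrix.trace_mul_single]

theorem eq_of_pairing_left (h : ∀ C, pairing Z C = pairing W C) : Z = W := by
  ext i j
  have him := h (Matrix.single j i 1)
  have hre := h (Matrix.single j i Complex.I)
  rw [pairing_single, pairing_single] at him hre
  exact Complex.ext (by simpa using hre) (by simpa using him)

/-- The linear form `⟨Z, ·⟩`. -/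
noncomputable def pairingLeft (Z : Mat n) : Mat n →L[ℝ] ℝ :=
  LinearMap.toContinuousLinearMap
    (Complex.imLm ∘ₗ (traceLinearMap (Fin n) ℝ ℂ ∘ₗ LinearMap.mulLeft ℝ Z))

theorem grad_eq {L : Mat n →L[ℝ] ℝ} (hφ : HasFDerivAt φ L B) (hZ : ∀ C, L C = pairing Z C) :
    grad φ B = Z :=
  eq_of_pairing_left fun C => by rw [pairing_grad, hφ.fderiv, hZ]

theorem grad_pairing (Z B : Mat n) : grad (pairing Z) B = Z :=
  grad_eq (pairingLeft Z).hasFDerivAt fun _ => rfl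

theorem contDiff_pairing (Z : Mat n) : ContDiff ℝ ∞ (pairing Z) :=
  (pairingLeft Z).contDiff

theorem R_eq_sub_piA (X : Mat n) : R X = X - (2 : ℝ) • piA X := by
  rw [R, piL, two_smul]
  abel

/-- The value at `B` of the Hamiltonian vector field of `φ`, in terms of the projection
onto `𝔞`. -/
noncomputable def hamiltonianVector (φ : Mat n → ℝ) (B : Mat n) : Mat n :=
  piA (B * grad φ B) * B - B * piA (grad φ B * B)

theorem poissonBracket_eq_pairing (φ ψ : Mat n → ℝ) (B : Mat n) :
    poissonBracket φ ψ B = pairing (grad ψ B) (hamiltonianVector φ B) := by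
  have hleft : (R (grad φ B * B) * (grad ψ B * B)).trace =
      (grad ψ B * (B * R (grad φ B * B))).trace := by
    rw [Matrix.trace_mul_comm, mul_assoc]
  have hright : (R (B * grad φ B) * (B * grad ψ B)).trace =
      (grad ψ B * (R (B * grad φ B) * B)).trace := by
    rw [← mul_assoc, Matrix.trace_mul_comm]
  have hV : hamiltonianVector φ B =
      (1 / 2 : ℝ) • (B * R (grad φ B * B) - R (B * grad φ B) * B) := by
    rw [hamiltonianVector, R_eq_sub_piA, R_eq_sub_piA, mul_sub, sub_mul, mul_smul_comm,
      smul_mul_assoc, ← mul_assoc]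
    module
  simp only [poissonBracket, pairing, hleft, hright, hV, mul_smul_comm, mul_sub,
    Matrix.trace_smul, Matrix.trace_sub, Complex.smul_im, Complex.sub_im, smul_eq_mul]

theorem isHamiltonianVector_iff : IsHamiltonianVector φ B V ↔ V = hamiltonianVector φ B := by
  refine ⟨fun h => eq_of_pairing_left fun Z => ?_, ?_⟩
  · have hZ := h (pairing Z) (contDiff_pairing Z)
    rw [poissonBracket_eq_pairing, ← pairing_grad, grad_pairing] at hZ
    rw [pairing_comm, hZ, pairing_comm]
  · rintro rfl ψ -
    rw [poissonBracket_eq_pairing, pairing_grad]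

end HamiltonianVector

section HamiltonianCurve

variable {n : ℕ}

theorem continuous_piA : Continuous (piA : Mat n → Mat n) := by
  refine continuous_pi fun i => continuous_pi fun j => ?_
  have hentry (i j : Fin n) : Continuous fun X : Mat n => X i j := continuous_apply_apply i j
  simp only [piA, of_apply]
  split_ifs
  · exact hentry i j
  · exact (Complex.continuous_conj.comp (hentry j i)).neg
  · exact continuous_const.mul
      (Complex.continuous_ofReal.comp (Complex.continuous_im.comp (hentry i i)))

theorem continuous_piL : Continuous (piL : Mat n → Mat n) :=
  continuous_id.sub continuous_piA

theorem trace_piA (X : Mat n) : (piA X).trace = Complex.I * X.trace.im := by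
  simp [Matrix.trace, piA, Finset.mul_sum]

namespace IsHamiltonianCurve

variable {U : Set (Mat n)} {φ : Mat n → ℝ} {s : Set ℝ} {γ : ℝ → Mat n} {t₀ t : ℝ}

theorem continuousOn (h : IsHamiltonianCurve U φ s γ) : ContinuousOn γ s := fun t ht => by
  obtain ⟨V, -, hV⟩ := h.deriv t ht
  exact hV.continuousWithinAt

theorem continuousOn_grad (h : IsHamiltonianCurve U φ s γ) :
    ContinuousOn (fun t => grad φ (γ t)) s := by
  have hfderiv : ContinuousOn (fun t => fderiv ℝ φ (γ t)) s :=
    (h.smooth.continuousOn_fderiv_of_isOpen h.isOpen (by simp)).comp h.continuousOn h.mem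
  have hentry (C : Mat n) : ContinuousOn (fun t => (fderiv ℝ φ (γ t) C : ℂ)) s :=
    Complex.continuous_ofReal.comp_continuousOn (hfderiv.clm_apply continuousOn_const)
  exact continuousOn_pi.2 fun i => continuousOn_pi.2 fun j =>
    (hentry _).add (continuousOn_const.mul (hentry _))

theorem isLaxFlow_piA (h : IsHamiltonianCurve U φ s γ) :
    IsLaxFlow s (fun t => piA (γ t * grad φ (γ t))) (fun t => piA (grad φ (γ t) * γ t)) γ := by
  refine ⟨h.ordConnected, continuous_piA.comp_continuousOn (h.continuousOn.mul h.continuousOn_grad),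
    continuous_piA.comp_continuousOn (h.continuousOn_grad.mul h.continuousOn), fun t ht => ?_⟩
  obtain ⟨V, hV, hd⟩ := h.deriv t ht
  rwa [isHamiltonianVector_iff.1 hV] at hd

theorem isLaxFlow_neg_piL (h : IsHamiltonianCurve U φ s γ) :
    IsLaxFlow s (fun t => -piL (γ t * grad φ (γ t))) (fun t => -piL (grad φ (γ t) * γ t)) γ :=
  h.isLaxFlow_piA.congr
    (continuous_piL.comp_continuousOn (h.continuousOn.mul h.continuousOn_grad)).neg
    (continuous_piL.comp_continuousOn (h.continuousOn_grad.mul h.continuousOn)).neg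
    fun t _ => by
      simp only [piL]
      noncomm_ring

theorem mem_unitaryGroup (h : IsHamiltonianCurve U φ s γ) (ht₀ : t₀ ∈ s) (ht : t ∈ s)
    (hU : γ t₀ ∈ unitaryGroup (Fin n) ℂ) : γ t ∈ unitaryGroup (Fin n) ℂ :=
  h.isLaxFlow_piA.mem_unitaryGroup (fun _ _ => piA_mem _) (fun _ _ => piA_mem _) ht₀ ht hU

theorem det_eq (h : IsHamiltonianCurve U φ s γ) (ht₀ : t₀ ∈ s) (ht : t ∈ s) :
    (γ t).det = (γ t₀).det :=
  h.isLaxFlow_piA.det_eq (fun t _ => by rw [trace_piA, trace_piA, Matrix.trace_mul_comm]) ht₀ ht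

theorem isLaxFlow_star (h : IsHamiltonianCurve U φ s γ)
    (hU : ∀ t ∈ s, γ t ∈ unitaryGroup (Fin n) ℂ) :
    IsLaxFlow s (fun t => -piL (grad φ (γ t) * γ t)) (fun t => -piL (γ t * grad φ (γ t)))
      fun t => star (γ t) :=
  (h.isLaxFlow_piA.star (fun _ _ => piA_mem _) fun _ _ => piA_mem _).congr
    h.isLaxFlow_neg_piL.continuousOn_right h.isLaxFlow_neg_piL.continuousOn_left
    fun t ht => by
      have hcancel : star (γ t) * (γ t * grad φ (γ t)) = grad φ (γ t) * γ t * star (γ t) := by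
        rw [← mul_assoc, mem_unitaryGroup_iff'.1 (hU t ht), mul_assoc,
          mem_unitaryGroup_iff.1 (hU t ht), one_mul, mul_one]
      simp only [piL, neg_sub, sub_mul, mul_sub, hcancel]
      abel

end IsHamiltonianCurve

end HamiltonianCurve

/-! ### The determinant is a Casimir -/

section Casimir

variable {n : ℕ}

theorem exists_eq_im_mul (L : ℂ →L[ℝ] ℝ) : ∃ w : ℂ, ∀ z, L z = (w * z).im := by
  refine ⟨⟨L Complex.I, L 1⟩, fun z => ?_⟩
  have hz : z = z.re • (1 : ℂ) + z.im • Complex.I := Complex.ext (by simp) (by simp)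
  conv_lhs => rw [hz, map_add, map_smul, map_smul]
  rw [Complex.mul_im, smul_eq_mul, smul_eq_mul]
  ring

theorem exists_grad_comp_det {g : ℂ → ℝ} {B : Mat n} (hg : DifferentiableAt ℝ g B.det) :
    ∃ w : ℂ, grad (fun X => g X.det) B = w • adjugate B := by
  obtain ⟨w, hw⟩ := exists_eq_im_mul (fderiv ℝ g B.det)
  refine ⟨w, grad_eq (hg.hasFDerivAt.comp B ((hasFDerivAt_det B).restrictScalars ℝ)) fun C => ?_⟩
  rw [pairing, smul_mul_assoc, Matrix.trace_smul]
  exact hw _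

theorem pairing_R_smul_one_congr (c : ℂ) {X Y : Mat n} (h : X.trace = Y.trace) :
    pairing (R (c • 1)) X = pairing (R (c • 1)) Y := by
  have hR : R (c • 1 : Mat n) = star c • 1 := by
    ext i j
    rcases lt_trichotomy i j with hij | rfl | hij
    · simp [R, piL, piA, hij, hij.ne]
    · apply Complex.ext <;> simp [R, piL, piA]
    · simp [R, piL, piA, hij, hij.not_gt, hij.ne, hij.ne']
  rw [hR, pairing, pairing, smul_one_mul, smul_one_mul, Matrix.trace_smul, Matrix.trace_smul, h]

theorem poissonBracket_comp_det {g : ℂ → ℝ} {B : Mat n} (hg : DifferentiableAt ℝ g B.det)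
    (ψ : Mat n → ℝ) : poissonBracket (fun X => g X.det) ψ B = 0 := by
  obtain ⟨w, hw⟩ := exists_grad_comp_det hg
  rw [poissonBracket, hw, smul_mul_assoc, adjugate_mul, mul_smul_comm, mul_adjugate, smul_smul,
    pairing_R_smul_one_congr _ (Matrix.trace_mul_comm (grad ψ B) B), sub_self]

end Casimir

/-! ### CMV matrices are the unitary matrices of CMV shape -/

section OneSum

variable {n : ℕ}

/-- The block diagonal matrix `1 ⊕ X`. -/
def oneSum (X : Mat n) : Mat (n + 1) :=
  Matrix.of (Fin.cons (Fin.cons 1 fun _ => 0) fun i => Fin.cons 0 (X i))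

@[simp] theorem oneSum_zero_zero (X : Mat n) : oneSum X 0 0 = 1 := rfl

@[simp] theorem oneSum_zero_succ (X : Mat n) (j : Fin n) : oneSum X 0 j.succ = 0 := rfl

@[simp] theorem oneSum_succ_zero (X : Mat n) (i : Fin n) : oneSum X i.succ 0 = 0 := rfl

@[simp] theorem oneSum_succ_succ (X : Mat n) (i j : Fin n) : oneSum X i.succ j.succ = X i j := rfl

@[simp] theorem oneSum_one_zero (X : Mat (n + 1)) : oneSum X 1 0 = 0 := rfl

@[simp] theorem oneSum_one_succ (X : Mat (n + 1)) (j : Fin (n + 1)) :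
    oneSum X 1 j.succ = X 0 j := rfl

theorem oneSum_injective : Function.Injective (oneSum (n := n)) := fun X Y h => by
  ext i j
  simpa using congrFun (congrFun h i.succ) j.succ

theorem oneSum_mul (X Y : Mat n) : oneSum (X * Y) = oneSum X * oneSum Y := by
  ext i j
  cases i using Fin.cases <;> cases j using Fin.cases <;>
    simp [Matrix.mul_apply, Fin.sum_univ_succ]

theorem oneSum_one : oneSum (1 : Mat n) = 1 := by
  ext i j
  cases i using Fin.cases <;> cases j using Fin.cases <;>
    simp [Matrix.one_apply, (Fin.succ_ne_zero _).symm]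

theorem star_oneSum (X : Mat n) : star (oneSum X) = oneSum (star X) := by
  ext i j
  cases i using Fin.cases <;> cases j using Fin.cases <;> simp [Matrix.star_apply]

theorem oneSum_mem_unitaryGroup {X : Mat n} :
    oneSum X ∈ unitaryGroup (Fin (n + 1)) ℂ ↔ X ∈ unitaryGroup (Fin n) ℂ := by
  rw [mem_unitaryGroup_iff, mem_unitaryGroup_iff, star_oneSum, ← oneSum_mul, ← oneSum_one,
    oneSum_injective.eq_iff]

theorem exists_eq_oneSum {D : Mat (n + 1)} (hD : D ∈ unitaryGroup (Fin (n + 1)) ℂ)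
    (hcol : ∀ i, D i 0 = (1 : Mat (n + 1)) i 0) : ∃ X ∈ unitaryGroup (Fin n) ℂ, D = oneSum X := by
  have h00 : D 0 0 = 1 := hcol 0
  have hcol' (i : Fin n) : D i.succ 0 = 0 := hcol i.succ
  have hrow (j : Fin n) : D 0 j.succ = 0 := by
    have h := congrFun (congrFun (mem_unitaryGroup_iff'.1 hD) 0) j.succ
    simpa [Matrix.mul_apply, Fin.sum_univ_succ, Matrix.star_apply, h00, hcol', Matrix.one_apply,
      (Fin.succ_ne_zero _).symm] using h
  have hsum : D = oneSum (D.submatrix Fin.succ Fin.succ) := by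
    ext i j
    cases i using Fin.cases <;> cases j using Fin.cases <;> simp [h00, hcol', hrow]
  exact ⟨_, oneSum_mem_unitaryGroup.1 (hsum ▸ hD), hsum⟩

theorem exists_eq_mul_oneSum {C G : Mat (n + 1)} (hC : C ∈ unitaryGroup (Fin (n + 1)) ℂ)
    (hG : G ∈ unitaryGroup (Fin (n + 1)) ℂ) (hcol : ∀ i, C i 0 = G i 0) :
    ∃ X ∈ unitaryGroup (Fin n) ℂ, C = G * oneSum X := by
  have hcol' (i : Fin (n + 1)) : (star G * C) i 0 = (1 : Mat (n + 1)) i 0 := by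
    rw [← mem_unitaryGroup_iff'.1 hG, Matrix.mul_apply, Matrix.mul_apply]
    simp only [hcol]
  obtain ⟨X, hX, hD⟩ := exists_eq_oneSum (mul_mem (Unitary.star_mem hG) hC) hcol'
  refine ⟨X, hX, ?_⟩
  rw [← hD, ← mul_assoc, mem_unitaryGroup_iff.1 hG, one_mul]

end OneSum

section Rotation

variable {n : ℕ} {a : ℂ}

theorem rho_pos (ha : ‖a‖ < 1) : 0 < rho a :=
  Real.sqrt_pos.2 (by nlinarith [norm_nonneg a])

theorem rho_mul_rho (ha : ‖a‖ ≤ 1) : (rho a : ℂ) * rho a = 1 - a * (starRingEnd ℂ) a := by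
  rw [Complex.mul_conj, Complex.normSq_eq_norm_sq, ← Complex.ofReal_mul, rho,
    Real.mul_self_sqrt (by nlinarith [norm_nonneg a])]
  push_cast
  ring

/-- The block diagonal matrix `Ξ ⊕ 1`, with `Ξ = [[conj a, ρ], [ρ, -a]]` in the first two rows and
columns. -/
noncomputable def rotation (n : ℕ) (a : ℂ) : Mat (n + 2) :=
  Matrix.of (Fin.cons (Fin.cons ((starRingEnd ℂ) a) (Fin.cons (rho a : ℂ) fun _ => 0))
    (Fin.cons (Fin.cons (rho a : ℂ) (Fin.cons (-a) fun _ => 0))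
      fun i => Fin.cons 0 (Fin.cons 0 fun j => (1 : Mat n) i j)))

theorem rotation_mul_zero (a : ℂ) (X : Mat (n + 2)) (j : Fin (n + 2)) :
    (rotation n a * X) 0 j = (starRingEnd ℂ) a * X 0 j + rho a * X 1 j := by
  simp [Matrix.mul_apply, Fin.sum_univ_succ, rotation]

theorem rotation_mul_one (a : ℂ) (X : Mat (n + 2)) (j : Fin (n + 2)) :
    (rotation n a * X) 1 j = rho a * X 0 j - a * X 1 j := by
  simp [show (1 : Fin (n + 2)) = Fin.succ 0 from rfl, Matrix.mul_apply, Fin.sum_univ_succ,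
    rotation, sub_eq_add_neg, -Fin.succ_zero_eq_one, -Fin.succ_zero_eq_one']

theorem rotation_mul_succ_succ (a : ℂ) (X : Mat (n + 2)) (i : Fin n) (j : Fin (n + 2)) :
    (rotation n a * X) i.succ.succ j = X i.succ.succ j := by
  simp [Matrix.mul_apply, Fin.sum_univ_succ, rotation, Matrix.one_apply]

theorem rotation_mul_oneSum_zero_succ (a : ℂ) (X : Mat (n + 1)) (j : Fin (n + 1)) :
    (rotation n a * oneSum X) 0 j.succ = rho a * X 0 j := by
  simp [rotation_mul_zero]

theorem rotation_mul_oneSum_one_succ (a : ℂ) (X : Mat (n + 1)) (j : Fin (n + 1)) :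
    (rotation n a * oneSum X) 1 j.succ = -a * X 0 j := by
  simp [rotation_mul_one]

theorem rotation_mem_unitaryGroup (ha : ‖a‖ ≤ 1) :
    rotation n a ∈ unitaryGroup (Fin (n + 2)) ℂ := by
  have hρ := rho_mul_rho ha
  have hne (i : Fin n) : i.succ.succ ≠ 1 := fun h => Fin.succ_ne_zero i (Fin.succ_injective _ h)
  rw [mem_unitaryGroup_iff]
  ext i j
  refine Fin.cases ?_ (Fin.cases ?_ fun i => ?_) i <;>
    refine Fin.cases ?_ (Fin.cases ?_ fun j => ?_) j <;>
    simp [Matrix.mul_apply, Fin.sum_univ_succ, Matrix.star_apply, rotation, Matrix.one_apply,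
      (Fin.succ_ne_zero _).symm, hne, (hne _).symm, hρ, mul_comm]

theorem sum_norm_sq_col_eq_one {ι 𝕜 : Type*} [Fintype ι] [DecidableEq ι] [RCLike 𝕜]
    {C : Matrix ι ι 𝕜} (hC : C ∈ unitaryGroup ι 𝕜) (j : ι) : ∑ i, ‖C i j‖ ^ 2 = 1 := by
  have h := congrFun (congrFun (mem_unitaryGroup_iff'.1 hC) j) j
  simp only [Matrix.mul_apply, Matrix.star_apply, RCLike.star_def, RCLike.conj_mul,
    Matrix.one_apply_eq] at h
  exact_mod_cast h

theorem exists_eq_rotation_mul_oneSum {C : Mat (n + 2)}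
    (hC : C ∈ unitaryGroup (Fin (n + 2)) ℂ) (hpos : 0 < (C 1 0).re ∧ (C 1 0).im = 0)
    (hcol : ∀ i : Fin n, C i.succ.succ 0 = 0) :
    ∃ a : ℂ, ‖a‖ < 1 ∧
      ∃ X ∈ unitaryGroup (Fin (n + 1)) ℂ, C = rotation n a * oneSum X := by
  set a : ℂ := (starRingEnd ℂ) (C 0 0) with ha
  have hC10 : C 1 0 = ((C 1 0).re : ℂ) := Complex.ext rfl hpos.2
  have hnorm : ‖a‖ ^ 2 + (C 1 0).re ^ 2 = 1 := by
    have h := sum_norm_sq_col_eq_one hC 0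
    rw [Fin.sum_univ_succ, Fin.sum_univ_succ] at h
    simp only [hcol, norm_zero, ne_eq, OfNat.ofNat_ne_zero, not_false_eq_true, zero_pow,
      Finset.sum_const_zero, add_zero, Fin.succ_zero_eq_one] at h
    rwa [hC10, Complex.norm_real, Real.norm_eq_abs, sq_abs, ← Complex.norm_conj] at h
  have hlt : ‖a‖ < 1 := by nlinarith [norm_nonneg a, hpos.1]
  have hrho : C 1 0 = rho a := by
    rw [hC10, rho, ← hnorm, add_sub_cancel_left, Real.sqrt_sq hpos.1.le]
  refine ⟨a, hlt, exists_eq_mul_oneSum hC (rotation_mem_unitaryGroup hlt.le) ?_⟩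
  refine Fin.cases ?_ (Fin.cases hrho fun i => hcol i)
  rw [ha]
  exact (Complex.conj_conj _).symm

end Rotation

section CMVFactor

variable {n : ℕ}

theorem transpose_cmvFactor (p : ℕ) (α : Fin n → ℂ) : (cmvFactor p α)ᵀ = cmvFactor p α := by
  ext i j
  rcases eq_or_ne i j with rfl | hij
  · rfl
  · have hij' : (i : ℕ) ≠ j := Fin.val_ne_of_ne hij
    simp only [cmvFactor, transpose_apply, of_apply, if_neg hij', if_neg hij'.symm]
    split_ifs <;> first | rfl | omega

theorem cmvFactor_one (α : Fin (n + 1) → ℂ) :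
    cmvFactor 1 α = oneSum (cmvFactor 0 (Fin.tail α)) := by
  ext i j
  refine Fin.cases ?_ (fun i => ?_) i <;> refine Fin.cases ?_ (fun j => ?_) j
  · simp [cmvFactor]
  · simp [cmvFactor]
  · simp [cmvFactor]
  · have hodd (k : ℕ) : (k + 1) % 2 = 1 ↔ k % 2 = 0 := by omega
    simp only [oneSum_succ_succ, cmvFactor, of_apply, Fin.val_succ, Fin.tail, hodd, add_left_inj]
    split_ifs <;> first | rfl | omega | contradiction | skip
    exact congrArg (fun k => -α k) (Fin.ext (by simp only [Fin.val_succ]; omega))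

theorem cmvFactor_zero (α : Fin (n + 2) → ℂ) :
    cmvFactor 0 α = rotation n (α 0) * oneSum (cmvFactor 1 (Fin.tail α)) := by
  ext i j
  refine Fin.cases ?_ (Fin.cases ?_ fun i => ?_) i
  · refine Fin.cases ?_ (fun j => ?_) j
    · simp [rotation_mul_zero, cmvFactor]
    · rw [rotation_mul_oneSum_zero_succ]
      refine Fin.cases ?_ (fun j => ?_) j <;> simp [cmvFactor]
  · refine Fin.cases ?_ (fun j => ?_) j
    · simp [rotation_mul_one, cmvFactor]
    · rw [Fin.succ_zero_eq_one, rotation_mul_oneSum_one_succ]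
      refine Fin.cases ?_ (fun j => ?_) j <;> simp [cmvFactor]
  · rw [rotation_mul_succ_succ]
    refine Fin.cases ?_ (fun j => ?_) j
    · simp [cmvFactor]
    · have hodd (k : ℕ) : (k + 1) % 2 = 1 ↔ k % 2 = 0 := by omega
      have heven (k : ℕ) : (k + 1) % 2 = 0 ↔ k % 2 = 1 := by omega
      simp only [oneSum_succ_succ, cmvFactor, of_apply, Fin.val_succ, Fin.tail, hodd, heven,
        add_left_inj]
      split_ifs <;> rfl

theorem cmvMatrix_eq_rotation_mul_oneSum (α : Fin (n + 2) → ℂ) :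
    cmvMatrix α = rotation n (α 0) * oneSum (cmvMatrix (Fin.tail α))ᵀ := by
  rw [cmvMatrix, cmvMatrix, Matrix.transpose_mul, transpose_cmvFactor, transpose_cmvFactor,
    oneSum_mul, cmvFactor_zero, cmvFactor_one α, mul_assoc]

theorem isVerblunsky_one {α : Fin 1 → ℂ} : IsVerblunsky α ↔ ‖α 0‖ = 1 := by
  simp [IsVerblunsky]

theorem isVerblunsky_add_two {α : Fin (n + 2) → ℂ} :
    IsVerblunsky α ↔ ‖α 0‖ < 1 ∧ IsVerblunsky (Fin.tail α) := by
  simp [IsVerblunsky, Fin.forall_fin_succ (n := n + 1), Fin.tail]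

theorem isCMV_add_two {C : Mat (n + 2)} : IsCMV C ↔
    ∃ a : ℂ, ‖a‖ < 1 ∧ ∃ X : Mat (n + 1), IsCMV X ∧ C = rotation n a * oneSum Xᵀ := by
  constructor
  · rintro ⟨α, hα, rfl⟩
    obtain ⟨h0, htail⟩ := isVerblunsky_add_two.1 hα
    exact ⟨α 0, h0, _, ⟨_, htail, rfl⟩, cmvMatrix_eq_rotation_mul_oneSum α⟩
  · rintro ⟨a, ha, _, ⟨α, hα, rfl⟩, rfl⟩
    exact ⟨Fin.cons a α, isVerblunsky_add_two.2 ⟨ha, hα⟩,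
      (cmvMatrix_eq_rotation_mul_oneSum (Fin.cons a α)).symm⟩

end CMVFactor

section CMVShape

variable {n : ℕ}

/-- The positions outside of which matrices of CMV shape vanish. -/
def InBand (i j : Fin n) : Prop :=
  2 * ((i : ℕ) / 2) ≤ (j : ℕ) + 1 ∧ (j : ℕ) ≤ 2 * ((i : ℕ) / 2) + 2

/-- The condition that CMV shape imposes on the entry `z` in the position `(i, j)`. -/
def IsCMVEntry (i j : Fin n) (z : ℂ) : Prop :=
  (¬ InBand i j → z = 0) ∧ (IsExposed i j → 0 < z.re ∧ z.im = 0)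

theorem hasCMVShape_iff {C : Mat n} : HasCMVShape C ↔ ∀ i j, IsCMVEntry i j (C i j) := by
  simp only [HasCMVShape, IsCMVEntry, InBand, forall_and]

theorem isCMVEntry_zero_succ (j : Fin (n + 1)) {r : ℝ} (hr : 0 < r) {z : ℂ} :
    IsCMVEntry (n := n + 2) 0 j.succ (r * z) ↔ IsCMVEntry j 0 z := by
  have hband : InBand (n := n + 2) 0 j.succ ↔ InBand j 0 := by
    simp only [InBand, Fin.val_zero, Fin.val_succ]
    omega
  have hexposed : IsExposed (n := n + 2) 0 j.succ ↔ IsExposed j 0 := by simp [IsExposed]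
  simp [IsCMVEntry, hband, hexposed, hr, hr.ne']

theorem isCMVEntry_one_succ {j : Fin (n + 1)} {z : ℂ} (hz : IsCMVEntry j 0 z) (w : ℂ) :
    IsCMVEntry (n := n + 2) 1 j.succ (w * z) := by
  refine ⟨fun h => ?_, fun h => ?_⟩
  · have hj : ¬InBand j 0 := by
      simp only [InBand, Fin.val_zero, Fin.val_one, Fin.val_succ] at h ⊢
      omega
    rw [hz.1 hj, mul_zero]
  · simp [IsExposed] at h

theorem isCMVEntry_succ_succ_succ (i : Fin n) (j : Fin (n + 1)) {z : ℂ} :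
    IsCMVEntry i.succ.succ j.succ z ↔ IsCMVEntry j i.succ z := by
  have hband : InBand i.succ.succ j.succ ↔ InBand j i.succ := by
    simp only [InBand, Fin.val_succ]
    omega
  have hexposed : IsExposed i.succ.succ j.succ ↔ IsExposed j i.succ := by
    simp only [IsExposed, Fin.val_succ]
    omega
  rw [IsCMVEntry, IsCMVEntry, hband, hexposed]

theorem isCMVEntry_succ_succ_zero (i : Fin n) : IsCMVEntry i.succ.succ 0 0 := by
  simp [IsCMVEntry, IsExposed]

theorem hasCMVShape_rotation_mul_oneSum {a : ℂ} (ha : ‖a‖ < 1) {X : Mat (n + 1)} :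
    HasCMVShape (rotation n a * oneSum Xᵀ) ↔ HasCMVShape X := by
  have hρ := rho_pos ha
  rw [hasCMVShape_iff, hasCMVShape_iff]
  constructor
  · intro h j i
    refine Fin.cases ?_ (fun i => ?_) i
    · rw [← isCMVEntry_zero_succ j hρ, ← X.transpose_apply, ← rotation_mul_oneSum_zero_succ]
      exact h 0 j.succ
    · rw [← isCMVEntry_succ_succ_succ, ← X.transpose_apply, ← oneSum_succ_succ Xᵀ,
        ← rotation_mul_succ_succ a (oneSum Xᵀ)]
      exact h i.succ.succ j.succ
  · intro h i j
    refine Fin.cases ?_ (Fin.cases ?_ fun i => ?_) i <;> refine Fin.cases ?_ (fun j => ?_) j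
    · simp [IsCMVEntry, InBand, IsExposed]
    · rw [rotation_mul_oneSum_zero_succ]
      exact (isCMVEntry_zero_succ j hρ).2 (h j 0)
    · simp [IsCMVEntry, InBand, rotation_mul_one, hρ]
    · rw [Fin.succ_zero_eq_one, rotation_mul_oneSum_one_succ]
      exact isCMVEntry_one_succ (h j 0) _
    · rw [rotation_mul_succ_succ]
      exact isCMVEntry_succ_succ_zero i
    · rw [rotation_mul_succ_succ]
      exact (isCMVEntry_succ_succ_succ i j).2 (h j i.succ)

theorem HasCMVShape.exists_eq_rotation_mul_oneSum {C : Mat (n + 2)} (hC : HasCMVShape C)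
    (hU : C ∈ unitaryGroup (Fin (n + 2)) ℂ) : ∃ a : ℂ, ‖a‖ < 1 ∧
      ∃ X ∈ unitaryGroup (Fin (n + 1)) ℂ, HasCMVShape X ∧ C = rotation n a * oneSum Xᵀ := by
  obtain ⟨a, ha, Y, hY, rfl⟩ := CMV.exists_eq_rotation_mul_oneSum hU (hC.2 1 0 (Or.inl ⟨rfl, rfl⟩))
    fun i => hC.1 _ _ (by simp only [Fin.val_zero, Fin.val_succ]; omega)
  exact ⟨a, ha, Yᵀ, transpose_mem_unitaryGroup_iff.2 hY,
    (hasCMVShape_rotation_mul_oneSum ha).1 hC, rfl⟩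

theorem isCMV_one_iff {C : Mat 1} : IsCMV C ↔ ‖C 0 0‖ = 1 := by
  refine ⟨?_, fun h => ⟨fun _ => (starRingEnd ℂ) (C 0 0), isVerblunsky_one.2 ?_, ?_⟩⟩
  · rintro ⟨α, hα, rfl⟩
    simpa [cmvMatrix, cmvFactor, Matrix.mul_apply] using isVerblunsky_one.1 hα
  · rwa [Complex.norm_conj]
  · ext i j
    fin_cases i
    fin_cases j
    simp [cmvMatrix, cmvFactor, Matrix.mul_apply]

theorem mem_unitaryGroup_one_iff {C : Mat 1} : C ∈ unitaryGroup (Fin 1) ℂ ↔ ‖C 0 0‖ = 1 := by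
  refine ⟨fun hC => ?_, fun h => mem_unitaryGroup_iff.2 ?_⟩
  · exact (pow_eq_one_iff_of_nonneg (norm_nonneg _) two_ne_zero).1
      ((Fin.sum_univ_one _).symm.trans (sum_norm_sq_col_eq_one hC 0))
  · ext i j
    fin_cases i
    fin_cases j
    simp [Matrix.mul_apply, Matrix.star_apply, Complex.mul_conj, Complex.normSq_eq_norm_sq, h]

theorem hasCMVShape_one (C : Mat 1) : HasCMVShape C :=
  hasCMVShape_iff.2 fun i j => by
    fin_cases i
    fin_cases j
    simp [IsCMVEntry, InBand, IsExposed]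

theorem isCMV_iff : ∀ {n : ℕ} {C : Mat n},
    IsCMV C ↔ C ∈ unitaryGroup (Fin n) ℂ ∧ HasCMVShape C
  | 0, C => ⟨fun _ => ⟨by rw [Subsingleton.elim C 1]; exact one_mem _, fun i => i.elim0,
      fun i => i.elim0⟩, fun _ => ⟨Fin.elim0, fun k => k.elim0, Subsingleton.elim _ _⟩⟩
  | 1, C => by
    rw [isCMV_one_iff, mem_unitaryGroup_one_iff, and_iff_left (hasCMVShape_one C)]
  | n + 2, C => by
    rw [isCMV_add_two]
    constructor
    · rintro ⟨a, ha, X, hX, rfl⟩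
      obtain ⟨hXU, hXshape⟩ := isCMV_iff.1 hX
      exact ⟨mul_mem (rotation_mem_unitaryGroup ha.le)
        (oneSum_mem_unitaryGroup.2 (transpose_mem_unitaryGroup_iff.2 hXU)),
        (hasCMVShape_rotation_mul_oneSum ha).2 hXshape⟩
    · rintro ⟨hU, hC⟩
      obtain ⟨a, ha, X, hXU, hX, rfl⟩ := hC.exists_eq_rotation_mul_oneSum hU
      exact ⟨a, ha, X, isCMV_iff.2 ⟨hXU, hX⟩, rfl⟩

end CMVShape

/-! ### Preservation of the CMV shape -/

section Preservation

variable {n : ℕ}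

theorem not_inBand_upperRight_or_lowerLeft {i j : Fin n} (h : ¬ InBand i j) :
    (∀ i' ≤ i, ∀ j' ≥ j, ¬ InBand i' j') ∨ ∀ i' ≥ i, ∀ j' ≤ j, ¬ InBand i' j' := by
  simp only [InBand, Fin.le_def, ge_iff_le] at h ⊢
  rcases lt_or_ge ((j : ℕ) + 1) (2 * ((i : ℕ) / 2)) with hj | hj
  · exact Or.inr fun i' hi' j' hj' => by omega
  · exact Or.inl fun i' hi' j' hj' => by omega

theorem IsExposed.not_inBand_upperRight_or_lowerLeft {i j : Fin n} (h : IsExposed i j) :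
    (∀ i' ≤ i, ∀ j' ≥ j, (i', j') ≠ (i, j) → ¬ InBand i' j') ∨
      ∀ i' ≥ i, ∀ j' ≤ j, (i', j') ≠ (i, j) → ¬ InBand i' j' := by
  simp only [InBand, Fin.le_def, ge_iff_le, ne_eq, Prod.mk.injEq, Fin.ext_iff]
  rcases h with h | h | h
  · exact Or.inr fun i' hi' j' hj' => by omega
  · exact Or.inl fun i' hi' j' hj' => by omega
  · exact Or.inr fun i' hi' j' hj' => by omega

theorem IsHamiltonianCurve.hasCMVShape {U : Set (Mat n)} {φ : Mat n → ℝ} {s : Set ℝ}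
    {γ : ℝ → Mat n} {t₀ t : ℝ} (h : IsHamiltonianCurve U φ s γ) (ht₀ : t₀ ∈ s) (ht : t ∈ s)
    (hU : γ t₀ ∈ unitaryGroup (Fin n) ℂ) (hC : HasCMVShape (γ t₀)) : HasCMVShape (γ t) := by
  have hflow := h.isLaxFlow_neg_piL
  have hstar := h.isLaxFlow_star fun t ht => h.mem_unitaryGroup ht₀ ht hU
  have hleft : ∀ t ∈ s, -piL (γ t * grad φ (γ t)) ∈ lowerTri n := fun _ _ => neg_mem (piL_mem _)
  have hright : ∀ t ∈ s, -piL (grad φ (γ t) * γ t) ∈ lowerTri n := fun _ _ => neg_mem (piL_mem _)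
  have hzero (i j : Fin n) (hij : ¬ InBand i j) : γ t₀ i j = 0 := hC.1 i j hij
  have hstarzero (i j : Fin n) (hij : ¬ InBand i j) : (star (γ t₀)) j i = 0 := by
    rw [Matrix.star_apply, hzero i j hij, star_zero]
  refine ⟨fun i j hij => ?_, fun i j hij => ?_⟩
  · rcases not_inBand_upperRight_or_lowerLeft hij with hfar | hfar
    · exact hflow.entry_eq_zero hleft hright ht₀ ht fun i' hi' j' hj' =>
        hzero i' j' (hfar i' hi' j' hj')
    · exact star_eq_zero.1 (hstar.entry_eq_zero hright hleft ht₀ ht fun j' hj' i' hi' =>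
        hstarzero i' j' (hfar i' hi' j' hj'))
  · rcases hij.not_inBand_upperRight_or_lowerLeft with hfar | hfar
    · exact hflow.entry_pos hleft hright ht₀ ht
        (fun i' hi' j' hj' hne => hzero i' j' (hfar i' hi' j' hj' hne)) (hC.2 i j hij)
    · have hpos : 0 < ((star (γ t)) j i).re ∧ ((star (γ t)) j i).im = 0 :=
        hstar.entry_pos hright hleft ht₀ ht
          (fun j' hj' i' hi' hne => hstarzero i' j' (hfar i' hi' j' hj' fun heq =>
            hne (congrArg Prod.swap heq)))
          (by simpa [Matrix.star_apply] using hC.2 i j hij)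
      simpa [Matrix.star_apply] using hpos

theorem IsCMV.of_mem_symplecticLeaf {B C : Mat n} (hC : IsCMV C) (hB : B ∈ symplecticLeaf C) :
    IsCMV B ∧ B.det = C.det := by
  induction (hB : Relation.ReflTransGen HamiltonianStep C B) with
  | refl => exact ⟨hC, rfl⟩
  | tail _ hstep ih =>
    obtain ⟨U, φ, T, γ, hT, hγ, rfl, rfl⟩ := hstep
    have h0 : (0 : ℝ) ∈ Icc 0 T := left_mem_Icc.2 hT
    have hT' : T ∈ Icc 0 T := right_mem_Icc.2 hT
    obtain ⟨hU, hshape⟩ := isCMV_iff.1 ih.1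
    exact ⟨isCMV_iff.2 ⟨hγ.mem_unitaryGroup h0 hT' hU, hγ.hasCMVShape h0 hT' hU hshape⟩,
      (hγ.det_eq h0 hT').trans ih.2⟩

end Preservation

end CMV

theorem propositionP (n : ℕ) (hn : 1 ≤ n) :
    -- the leaf through a CMV matrix consists of CMV matrices of the same determinant
    (∀ C : CMV.Mat n, CMV.IsCMV C →
      ∀ B ∈ CMV.symplecticLeaf C, CMV.IsCMV B ∧ B.det = C.det) ∧
    -- the determinant is a Casimir: real functions of it Poisson commute with everything
    (∀ (B : CMV.Mat n) (g : ℂ → ℝ) (ψ : CMV.Mat n → ℝ),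
      DifferentiableAt ℝ g B.det → DifferentiableAt ℝ ψ B →
        CMV.poissonBracket (fun M => g M.det) ψ B = 0) ∧
    -- Hamiltonian flows preserve unitarity
    (∀ (U : Set (CMV.Mat n)) (φ : CMV.Mat n → ℝ) (s : Set ℝ) (γ : ℝ → CMV.Mat n),
      CMV.IsHamiltonianCurve U φ s γ → ∀ t₀ ∈ s, γ t₀ ∈ Matrix.unitaryGroup (Fin n) ℂ →
        ∀ t ∈ s, γ t ∈ Matrix.unitaryGroup (Fin n) ℂ) ∧
    -- Hamiltonian flows through CMV matrices stay in CMV shape, with positive exposed entries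
    (∀ (U : Set (CMV.Mat n)) (φ : CMV.Mat n → ℝ) (s : Set ℝ) (γ : ℝ → CMV.Mat n),
      CMV.IsHamiltonianCurve U φ s γ → ∀ t₀ ∈ s, CMV.IsCMV (γ t₀) →
        ∀ t ∈ s, CMV.HasCMVShape (γ t)) := by
  exact ⟨fun C hC B hB => hC.of_mem_symplecticLeaf hB,
    fun B g ψ hg _ => CMV.poissonBracket_comp_det hg ψ,
    fun U φ s γ h t₀ ht₀ hU t ht => h.mem_unitaryGroup ht₀ ht hU,
    fun U φ s γ h t₀ ht₀ hC t ht =>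
      h.hasCMVShape ht₀ ht (CMV.isCMV_iff.1 hC).1 (CMV.isCMV_iff.1 hC).2⟩
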